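/- Let $n\ge 1$, let $\Omega\subset\mathbb{R}^n$ be open and bounded, and let $D>0$ and $\lambda>0$ be constants. Let $H^1_0(\Omega)$ be the closure of $C_c^\infty(\Omega)$ in the norm $\|v\|_{H^1}=(\|v\|_{L^2}^2+\|\nabla v\|_{L^2}^2)^{1/2}$, and let $X=H^1_0(\Omega)\times H^1_0(\Omega)\times L^2(\Omega)^n\times L^2(\Omega)^n$ with its Hilbert product norm. For $U=(u,q,\mathbf r,\mathbf t)\in X$ and $V=(v,w,\mathbf s,\mathbf p)\in X$ put $$b(U,V)=\int_\Omega\Big[(\nabla u-\mathbf r)\cdot\mathbf s+(\nabla q-\mathbf t)\cdot\mathbf p-(u+q)\,v+\lambda\,\mathbf r\cdot\nabla v+D\,\mathbf t\cdot\nabla w\Big]\,dx .$$ Equivalently, $b(U,V)=a(U,V)+c((v,w),(\lambda\mathbf r,D\mathbf t))+c((u,q),(\mathbf s,\mathbf p))$, where $a(U,V)=-\int_\Omega[uv+qv+\mathbf r\cdot\mathbf s+\mathbf t\cdot\mathbf p]\,dx$ and $c((v,w),(\boldsymbol\varepsilon,\boldsymbol\varphi))=\int_\Omega[\boldsymbol\varepsilon\cdot\nabla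 v+\boldsymbol\varphi\cdot\nabla w]\,dx$. For a functional $F$ on $X$, consider the mixed weak problem (the weak form of the linear stationary Cahn–Hilliard system $\nabla u=\mathbf r$, $-u-\lambda\nabla\cdot\mathbf r=q$, $\nabla q=\mathbf t$, $D\,\nabla\cdot\mathbf t=f$ with $u=q=0$ on $\partial\Omega$ when $F(V)=-\int_\Omega f\,w\,dx$): find $U\in X$ such that $b(U,V)=F(V)$ for all $V\in X$. Call $\mu\in\mathbb{R}$ a Dirichlet eigenvalue of $-\Delta$ on $\Omega$ if there is $0\ne\phi\in H^1_0(\Omega)$ with $\int_\Omega\nabla\phi\cdot\nabla v\,dx=\mu\int_\Omega\phi v\,dx$ for all $v\in H^1_0(\Omega)$. Each of the following three statements holds if and only if $\lambda\mu\ne1$ for every Dirichlet eigenvalue $\mu$ of $-\Delta$ on $\Omega$. 1. The mixed weak problem is well posed for $L^2$ sources: for every $f\in L^2(\Omega)$ there is exactly one $U\in X$ with $b(U,V)=-\int_\Omega f\,w\,dx$ for all $V\in X$, and $\|U\|_X\le C\|f\|_{L^2}$ with a constant $C$ independent of $f$. 2. The mixed weak problem is well posed for general data: for every bounded linear functional $F$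 on $X$ there is exactly one $U\in X$ with $b(U,V)=F(V)$ for all $V\in X$, and $\|U\|_X\le C\|F\|_{X'}$ with a constant $C$ independent of $F$. 3. The form $b$ satisfies the inf-sup condition: there is $\gamma>0$ such that for all $U\in X$ $$\sup_{0\ne V\in X}\frac{|b(U,V)|}{\|V\|_X}\ \ge\ \gamma\,\|U\|_X .$$ -/

import Mathlib

open MeasureTheory
open scoped ContDiff

noncomputable section

namespace CahnHilliard

/-- The real Hilbert space `L²(Ω)` for `Ω ⊆ ℝⁿ` with Lebesgue measure. -/
abbrev L2 {n : ℕ} (Ω : Set (EuclideanSpace ℝ (Fin n))) : Type :=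
  Lp ℝ 2 ((volume : Measure (EuclideanSpace ℝ (Fin n))).restrict Ω)

/-- The real Hilbert space `L²(Ω)ⁿ` of square integrable vector fields on `Ω`. -/
abbrev L2vec {n : ℕ} (Ω : Set (EuclideanSpace ℝ (Fin n))) : Type :=
  Lp (EuclideanSpace ℝ (Fin n)) 2
    ((volume : Measure (EuclideanSpace ℝ (Fin n))).restrict Ω)

/-- `φ ∈ C_c^∞(Ω)`. -/
structure IsTest {n : ℕ} (Ω : Set (EuclideanSpace ℝ (Fin n)))
    (φ : EuclideanSpace ℝ (Fin n) → ℝ) : Prop where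
  smooth : ContDiff ℝ ∞ φ
  compact : HasCompactSupport φ
  support : tsupport φ ⊆ Ω

/-- The pairs `(φ, ∇φ)` with `φ ∈ C_c^∞(Ω)`, as a subspace of `L²(Ω) × L²(Ω)ⁿ`. The latter
carries the norm `(‖u‖² + ‖g‖²)^(1/2)`, which on these pairs is the `H¹(Ω)` norm of `φ`. -/
def testGraph {n : ℕ} (Ω : Set (EuclideanSpace ℝ (Fin n))) :
    Submodule ℝ (WithLp 2 (L2 Ω × L2vec Ω)) where
  carrier := {p | ∃ φ : EuclideanSpace ℝ (Fin n) → ℝ, IsTest Ω φ ∧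
    p.fst =ᵐ[volume.restrict Ω] φ ∧ p.snd =ᵐ[volume.restrict Ω] fun x => gradient φ x}
  zero_mem' := by
    refine ⟨0, ⟨contDiff_const, HasCompactSupport.zero, by simp⟩, ?_, ?_⟩
    · exact Lp.coeFn_zero _ _ _
    · have h : (fun x => gradient (0 : EuclideanSpace ℝ (Fin n) → ℝ) x) = 0 := by
        funext x
        simp [gradient]
      rw [h]
      exact Lp.coeFn_zero _ _ _
  add_mem' := by
    rintro p p' ⟨φ, hφ, h1, h2⟩ ⟨ψ, hψ, h3, h4⟩
    refine ⟨φ + ψ, ⟨hφ.smooth.add hψ.smooth, hφ.compact.add hψ.compact, ?_⟩, ?_, ?_⟩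
    · exact (tsupport_add φ ψ).trans (Set.union_subset hφ.support hψ.support)
    · exact (Lp.coeFn_add p.fst p'.fst).trans (h1.add h3)
    · refine (Lp.coeFn_add p.snd p'.snd).trans ?_
      filter_upwards [h2, h4] with x hx hy
      have d1 : DifferentiableAt ℝ φ x := (hφ.smooth.differentiable (by simp)) x
      have d2 : DifferentiableAt ℝ ψ x := (hψ.smooth.differentiable (by simp)) x
      simp [gradient, fderiv_add d1 d2, hx, hy]
  smul_mem' := by
    rintro c p ⟨φ, hφ, h1, h2⟩
    refine ⟨c • φ, ⟨hφ.smooth.const_smul c, ?_, ?_⟩, ?_, ?_⟩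
    · exact hφ.compact.mono (Function.support_const_smul_subset c φ)
    · exact (closure_mono (Function.support_const_smul_subset c φ)).trans hφ.support
    · exact (Lp.coeFn_smul c p.fst).trans (h1.const_smul c)
    · refine (Lp.coeFn_smul c p.snd).trans ?_
      filter_upwards [h2] with x hx
      have d1 : DifferentiableAt ℝ φ x := (hφ.smooth.differentiable (by simp)) x
      simp [gradient, fderiv_const_smul d1, hx]

/-- `H¹₀(Ω)`: the closure of `C_c^∞(Ω)` in the `H¹` norm. An element is stored as the pair
consisting of the function and its weak gradient, so the norm is the full `H¹(Ω)` norm. -/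
abbrev H10 {n : ℕ} (Ω : Set (EuclideanSpace ℝ (Fin n))) : Type :=
  (testGraph Ω).topologicalClosure

/-- The function underlying an element of `H¹₀(Ω)`. -/
def H10.val {n : ℕ} {Ω : Set (EuclideanSpace ℝ (Fin n))} (u : H10 Ω) : L2 Ω :=
  (u : WithLp 2 (L2 Ω × L2vec Ω)).fst

/-- The weak gradient of an element of `H¹₀(Ω)`. -/
def H10.grad {n : ℕ} {Ω : Set (EuclideanSpace ℝ (Fin n))} (u : H10 Ω) : L2vec Ω :=
  (u : WithLp 2 (L2 Ω × L2vec Ω)).snd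

/-- The trial and test space `H¹₀(Ω) × H¹₀(Ω) × L²(Ω)ⁿ × L²(Ω)ⁿ` with its Hilbert norm,
grouped as `((u, q), (r, t))`. -/
abbrev Space {n : ℕ} (Ω : Set (EuclideanSpace ℝ (Fin n))) : Type :=
  WithLp 2 (WithLp 2 (H10 Ω × H10 Ω) × WithLp 2 (L2vec Ω × L2vec Ω))

/-- The bilinear form
`b((u,q,r,t),(v,w,s,p)) = ∫_Ω (∇u - r)·s + (∇q - t)·p - (u + q) v + lam r·∇v + D t·∇w`. -/
def b {n : ℕ} (Ω : Set (EuclideanSpace ℝ (Fin n))) (D lam : ℝ) (U V : Space Ω) : ℝ :=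
  let u := U.fst.fst
  let q := U.fst.snd
  let r := U.snd.fst
  let t := U.snd.snd
  let v := V.fst.fst
  let w := V.fst.snd
  let s := V.snd.fst
  let p := V.snd.snd
  ∫ x in Ω, (inner ℝ (u.grad x - r x) (s x) + inner ℝ (q.grad x - t x) (p x)
    - (u.val x + q.val x) * v.val x
    + lam * inner ℝ (r x) (v.grad x) + D * inner ℝ (t x) (w.grad x))

/-- The form `a((u,q,r,t),(v,w,s,p)) = -∫_Ω u v + q v + r·s + t·p` of the mixed problem. -/
def a {n : ℕ} (Ω : Set (EuclideanSpace ℝ (Fin n))) (U V : Space Ω) : ℝ :=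
  -∫ x in Ω, (U.fst.fst.val x * V.fst.fst.val x + U.fst.snd.val x * V.fst.fst.val x
    + inner ℝ (U.snd.fst x) (V.snd.fst x) + inner ℝ (U.snd.snd x) (V.snd.snd x))

/-- The form `c((v,w),(ε,φ)) = ∫_Ω ε·∇v + φ·∇w` of the mixed problem. -/
def c {n : ℕ} (Ω : Set (EuclideanSpace ℝ (Fin n))) (v w : H10 Ω) (ε φ : L2vec Ω) : ℝ :=
  ∫ x in Ω, (inner ℝ (ε x) (v.grad x) + inner ℝ (φ x) (w.grad x))

/-- `U = (u,q,r,t)` solves the mixed weak problem with the functional `F` as right-hand side: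
`a(U,V) + c((v,w),(lam r, D t)) + c((u,q),(s,p)) = F(V)` for every `V = (v,w,s,p)`. -/
def IsMixedSolution {n : ℕ} (Ω : Set (EuclideanSpace ℝ (Fin n))) (D lam : ℝ)
    (F : Space Ω → ℝ) (U : Space Ω) : Prop :=
  ∀ V : Space Ω,
    a Ω U V + c Ω V.fst.fst V.fst.snd (lam • U.snd.fst) (D • U.snd.snd)
      + c Ω U.fst.fst U.fst.snd V.snd.fst V.snd.snd = F V

/-- The load `(v,w,s,p) ↦ ∫_Ω -f w`. -/
def load {n : ℕ} (Ω : Set (EuclideanSpace ℝ (Fin n))) (f : L2 Ω) (V : Space Ω) : ℝ :=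
  ∫ x in Ω, -(f x) * V.fst.snd.val x

/-- The mixed form is the bilinear form `b`. -/
theorem mixed_eq_b {n : ℕ} (Ω : Set (EuclideanSpace ℝ (Fin n))) (D lam : ℝ) (U V : Space Ω) :
    a Ω U V + c Ω V.fst.fst V.fst.snd (lam • U.snd.fst) (D • U.snd.snd)
      + c Ω U.fst.fst U.fst.snd V.snd.fst V.snd.snd = b Ω D lam U V := by
  have i1 (f g : L2 Ω) : Integrable (fun x => f x * g x) (volume.restrict Ω) := by
    simpa [mul_comm] using L2.integrable_inner (𝕜 := ℝ) f g
  have i2 (f g : L2vec Ω) : Integrable (fun x => inner ℝ (f x) (g x)) (volume.restrict Ω) :=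
    L2.integrable_inner (𝕜 := ℝ) f g
  simp only [a, b, c]
  rw [← integral_neg, ← integral_add, ← integral_add]
  · apply integral_congr_ae
    filter_upwards [Lp.coeFn_smul lam U.snd.fst, Lp.coeFn_smul D U.snd.snd] with x h1 h2
    rw [h1, h2]
    simp only [Pi.smul_apply, inner_smul_left, inner_sub_left,
      real_inner_comm (V.snd.fst x) (U.fst.fst.grad x),
      real_inner_comm (V.snd.snd x) (U.fst.snd.grad x)]
    simp
    ring
  · exact ((((i1 _ _).add (i1 _ _)).add (i2 _ _)).add (i2 _ _)).neg.add
      ((i2 _ _).add (i2 _ _))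
  · exact (i2 _ _).add (i2 _ _)
  · exact ((((i1 _ _).add (i1 _ _)).add (i2 _ _)).add (i2 _ _)).neg
  · exact (i2 _ _).add (i2 _ _)

/-- Well-posedness of the mixed weak problem for sources in `L²(Ω)`: existence, uniqueness and
continuous dependence on the source. -/
def WellPosed {n : ℕ} (Ω : Set (EuclideanSpace ℝ (Fin n))) (D lam : ℝ) : Prop :=
  (∀ f : L2 Ω, ∃! U : Space Ω, IsMixedSolution Ω D lam (load Ω f) U) ∧
  ∃ C : ℝ, ∀ (f : L2 Ω) (U : Space Ω), IsMixedSolution Ω D lam (load Ω f) U → ‖U‖ ≤ C * ‖f‖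

/-- Well-posedness of the mixed weak problem for every bounded linear functional on the test
space as right-hand side. -/
def WellPosedDual {n : ℕ} (Ω : Set (EuclideanSpace ℝ (Fin n))) (D lam : ℝ) : Prop :=
  (∀ F : Space Ω →L[ℝ] ℝ, ∃! U : Space Ω, IsMixedSolution Ω D lam F U) ∧
  ∃ C : ℝ, ∀ (F : Space Ω →L[ℝ] ℝ) (U : Space Ω), IsMixedSolution Ω D lam F U → ‖U‖ ≤ C * ‖F‖

/-- The inf-sup condition for `b`. -/
def InfSup {n : ℕ} (Ω : Set (EuclideanSpace ℝ (Fin n))) (D lam : ℝ) : Prop :=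
  ∃ γ : ℝ, 0 < γ ∧ ∀ U : Space Ω,
    γ * ‖U‖ ≤ ⨆ V : {V : Space Ω // V ≠ 0}, |b Ω D lam U V| / ‖(V : Space Ω)‖

/-- `μ` is an eigenvalue of the Dirichlet Laplacian `-Δ` on `Ω`. -/
def IsDirichletEigenvalue {n : ℕ} (Ω : Set (EuclideanSpace ℝ (Fin n))) (μ : ℝ) : Prop :=
  ∃ φ : H10 Ω, φ ≠ 0 ∧ ∀ v : H10 Ω,
    ∫ x in Ω, inner ℝ (φ.grad x) (v.grad x) = μ * ∫ x in Ω, φ.val x * v.val x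

end CahnHilliard

end

namespace CahnHilliard

open scoped ENNReal InnerProductSpace

/-! ### Translation, Poincaré and oscillation estimates for smooth functions. -/

section GradientEstimates

variable {E : Type*} [NormedAddCommGroup E] [InnerProductSpace ℝ E] [FiniteDimensional ℝ E]

/-! By Riesz, `b` is represented by a bounded operator B = `mixedOp`, and all three statements
become statements about B.

Solving B U = g is triangular. The slots s and p give r and t in terms of ∇u and ∇q. What remains is
D⟨∇q, ∇w⟩ = data for q alone, then lam⟨∇u, ∇v⟩ - ⟨u, v⟩ = data + ⟨q, v⟩ for u. Both are instances of
the Fredholm alternative `exists_forall_inner_sub_eq`, so uniqueness gives existence. For q,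
uniqueness is the Poincaré inequality `exists_norm_val_sq_le`; for u, it is the absence of the
eigenvalue 1 / lam. Then B is bijective, its inverse is bounded, and the stability bounds and the
inf-sup constant follow.

Conversely, an eigenfunction φ at 1 / lam puts (φ, 0, ∇φ, 0) in the kernel of B. This destroys
uniqueness already for zero data, hence for either class of data, and makes the inf-sup supremum
vanish.

The compactness in the Fredholm step is Rellich's theorem `isCompactOperator_valL`: up to a small
multiple of the gradient, the L² norm is controlled by finitely many integrals over small cubes. -/

theorem continuous_gradient {φ : E → ℝ} (hφ : ContDiff ℝ ∞ φ) :
    Continuous (fun y => gradient φ y) :=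
  (InnerProductSpace.toDual ℝ E).symm.continuous.comp (hφ.continuous_fderiv (by simp))

theorem tsupport_gradient_subset (φ : E → ℝ) : tsupport (fun x => gradient φ x) ⊆ tsupport φ := by
  refine closure_minimal (fun x hx => ?_) (isClosed_tsupport φ)
  exact support_fderiv_subset ℝ (f := φ) fun h => hx (by simp [gradient, h])

variable [MeasurableSpace E] [BorelSpace E]

/-- The squared mean of a function on `[0, 1]` is at most the mean of its square. -/
theorem sq_lintegral_unitInterval_le {f : ℝ → ℝ≥0∞} (hf : Measurable f) :
    (∫⁻ s in Set.Ioc (0 : ℝ) 1, f s) ^ 2 ≤ ∫⁻ s in Set.Ioc (0 : ℝ) 1, f s ^ 2 := by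
  have h := ENNReal.lintegral_mul_le_Lp_mul_Lq (volume.restrict (Set.Ioc (0 : ℝ) 1))
    Real.HolderConjugate.two_two hf.aemeasurable (aemeasurable_const (b := (1 : ℝ≥0∞)))
  simp only [Pi.mul_apply, mul_one, ENNReal.one_rpow, lintegral_const,
    Measure.restrict_apply_univ, Real.volume_Ioc, sub_zero, ENNReal.ofReal_one] at h
  calc _ ≤ ((∫⁻ s in Set.Ioc (0 : ℝ) 1, f s ^ (2 : ℝ)) ^ (1 / (2 : ℝ))) ^ 2 := by gcongr
    _ = _ := by
      rw [← ENNReal.rpow_natCast, ← ENNReal.rpow_mul]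
      simp

/-- The pointwise form of the translation estimate. -/
theorem enorm_translate_sub_sq_le {φ : E → ℝ} (hφ : ContDiff ℝ ∞ φ) (z x : E) :
    ‖φ (x + z) - φ x‖ₑ ^ 2 ≤
      ‖z‖ₑ ^ 2 * ∫⁻ s in Set.Ioc (0 : ℝ) 1, ‖gradient φ (x + s • z)‖ₑ ^ 2 := by
  have hg := continuous_gradient hφ
  have hd (s : ℝ) : HasDerivAt (fun s : ℝ => φ (x + s • z))
      (inner ℝ (gradient φ (x + s • z)) z) s := by
    have h1 : HasFDerivAt φ (fderiv ℝ φ (x + s • z)) (x + s • z) :=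
      ((hφ.differentiable (by simp)) _).hasFDerivAt
    have h2 : HasDerivAt (fun s : ℝ => x + s • z) z s := by
      simpa using ((hasDerivAt_id s).smul_const z).const_add x
    have := h1.comp_hasDerivAt s h2
    simpa [gradient, InnerProductSpace.toDual_symm_apply] using! this
  have hc : Continuous fun s : ℝ => (inner ℝ (gradient φ (x + s • z)) z : ℝ) :=
    (hg.comp (by fun_prop)).inner continuous_const
  have hF : φ (x + z) - φ x = ∫ s in Set.Ioc (0 : ℝ) 1, (inner ℝ (gradient φ (x + s • z)) z : ℝ) := by
    have := intervalIntegral.integral_eq_sub_of_hasDerivAt (a := 0) (b := 1) (fun s _ => hd s)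
      (hc.intervalIntegrable _ _)
    rw [intervalIntegral.integral_of_le zero_le_one] at this
    simpa using this.symm
  have hm : Measurable fun s : ℝ => ‖gradient φ (x + s • z)‖ₑ :=
    (hg.comp (by fun_prop : Continuous fun s : ℝ => x + s • z)).measurable.enorm
  calc ‖φ (x + z) - φ x‖ₑ ^ 2
      ≤ (∫⁻ s in Set.Ioc (0 : ℝ) 1, ‖z‖ₑ * ‖gradient φ (x + s • z)‖ₑ) ^ 2 := by
        rw [hF]
        gcongr
        refine (enorm_integral_le_lintegral_enorm _).trans (lintegral_mono fun s => ?_)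
        simp only [← ofReal_norm]
        rw [← ENNReal.ofReal_mul (norm_nonneg _), mul_comm]
        exact ENNReal.ofReal_le_ofReal (norm_inner_le_norm _ _)
    _ ≤ _ := by
        rw [lintegral_const_mul _ hm, mul_pow]
        gcongr
        exact sq_lintegral_unitInterval_le hm

/-- Translation estimate: `‖φ(· + z) - φ‖ ≤ ‖z‖ ‖∇φ‖` in `L²`. -/
theorem lintegral_translate_sub_sq_le {φ : E → ℝ} (hφ : ContDiff ℝ ∞ φ) (z : E) :
    ∫⁻ x, ‖φ (x + z) - φ x‖ₑ ^ 2 ≤ ‖z‖ₑ ^ 2 * ∫⁻ x, ‖gradient φ x‖ₑ ^ 2 := by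
  have hg := continuous_gradient hφ
  have hm : Measurable (Function.uncurry fun (x : E) (s : ℝ) => ‖gradient φ (x + s • z)‖ₑ ^ 2) :=
    ((hg.comp (by fun_prop : Continuous fun p : E × ℝ => p.1 + p.2 • z)).measurable.enorm).pow_const 2
  calc _ ≤ ∫⁻ x, ‖z‖ₑ ^ 2 * ∫⁻ s in Set.Ioc (0 : ℝ) 1, ‖gradient φ (x + s • z)‖ₑ ^ 2 :=
        lintegral_mono fun x => enorm_translate_sub_sq_le hφ z x
    _ = ‖z‖ₑ ^ 2 * ∫⁻ x, ∫⁻ s in Set.Ioc (0 : ℝ) 1, ‖gradient φ (x + s • z)‖ₑ ^ 2 :=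
        lintegral_const_mul _ hm.lintegral_prod_right
    _ = ‖z‖ₑ ^ 2 * ∫⁻ s in Set.Ioc (0 : ℝ) 1, ∫⁻ x, ‖gradient φ (x + s • z)‖ₑ ^ 2 := by
        rw [lintegral_lintegral_swap hm.aemeasurable]
    _ = _ := by
        congr 1
        simp [lintegral_add_right_eq_self (fun x => ‖gradient φ x‖ₑ ^ 2)]

theorem lintegral_enorm_sq_eq_ofReal {α F : Type*} [MeasurableSpace α] {ν : Measure α}
    [NormedAddCommGroup F] {f : α → F} (hf : Integrable (fun x => ‖f x‖ ^ 2) ν) :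
    ∫⁻ x, ‖f x‖ₑ ^ 2 ∂ν = ENNReal.ofReal (∫ x, ‖f x‖ ^ 2 ∂ν) := by
  rw [ofReal_integral_eq_lintegral_ofReal hf (ae_of_all _ fun x => by positivity)]
  simp [← ofReal_norm, ENNReal.ofReal_pow]

theorem integrable_norm_gradient_sq {φ : E → ℝ} (hφ : ContDiff ℝ ∞ φ)
    (hs : HasCompactSupport φ) : Integrable (fun x => ‖gradient φ x‖ ^ 2) := by
  have hc : HasCompactSupport (fun x => gradient φ x) :=
    hs.of_isClosed_subset (isClosed_tsupport _) (tsupport_gradient_subset φ)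
  refine Continuous.integrable_of_hasCompactSupport ((continuous_gradient hφ).norm.pow 2) ?_
  exact hc.comp_left (g := fun v => ‖v‖ ^ 2) (by simp)

theorem integrable_sq {φ : E → ℝ} (hφ : Continuous φ)
    (hs : HasCompactSupport φ) : Integrable (fun x => φ x ^ 2) :=
  Continuous.integrable_of_hasCompactSupport (hφ.pow 2)
    (hs.comp_left (g := fun v => v ^ 2) (by simp))

/-- Poincaré inequality for a function whose support is disjoint from its translate by `z`. -/
theorem two_mul_integral_sq_le {φ : E → ℝ} (hφ : ContDiff ℝ ∞ φ) (hs : HasCompactSupport φ)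
    {z : E} (hz : ∀ x, φ (x + z) * φ x = 0) :
    2 * ∫ x, φ x ^ 2 ≤ ‖z‖ ^ 2 * ∫ x, ‖gradient φ x‖ ^ 2 := by
  have h := lintegral_translate_sub_sq_le hφ z
  have hi := integrable_sq hφ.continuous hs
  -- The cross term vanishes by `hz`, so the translation estimate bounds twice the L² norm squared.
  have he : (fun x => ‖φ (x + z) - φ x‖ ^ 2) = fun x => φ (x + z) ^ 2 + φ x ^ 2 := by
    funext x
    rw [Real.norm_eq_abs, sq_abs]
    linear_combination -2 * hz x
  have hi' : Integrable fun x => φ (x + z) ^ 2 := hi.comp_add_right z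
  rw [lintegral_enorm_sq_eq_ofReal (by rw [he]; exact hi'.add hi),
    lintegral_enorm_sq_eq_ofReal (integrable_norm_gradient_sq hφ hs), he,
    integral_add hi' hi, integral_add_right_eq_self (fun x => φ x ^ 2), ← ofReal_norm,
    ← ENNReal.ofReal_pow (norm_nonneg _), ← ENNReal.ofReal_mul (by positivity),
    ENNReal.ofReal_le_ofReal_iff (by positivity)] at h
  linarith

section Variance

variable {α : Type*} [MeasurableSpace α] {ν : Measure α} [IsFiniteMeasure ν] {f : α → ℝ}

theorem integrable_norm_sub_sq (hf : Integrable f ν) (hf2 : Integrable (fun x => f x ^ 2) ν)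
    (c : ℝ) : Integrable (fun y => ‖c - f y‖ ^ 2) ν := by
  have he : (fun y => ‖c - f y‖ ^ 2) = fun y => c ^ 2 - 2 * c * f y + f y ^ 2 := by
    funext y
    rw [Real.norm_eq_abs, sq_abs]
    ring
  rw [he]
  exact ((integrable_const _).sub (hf.const_mul _)).add hf2

theorem integral_norm_sub_sq (hf : Integrable f ν) (hf2 : Integrable (fun x => f x ^ 2) ν)
    (c : ℝ) : ∫ y, ‖c - f y‖ ^ 2 ∂ν =
      ν.real Set.univ * c ^ 2 - 2 * (∫ y, f y ∂ν) * c + ∫ y, f y ^ 2 ∂ν := by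
  have he : (fun y => ‖c - f y‖ ^ 2) = fun y => c ^ 2 - 2 * c * f y + f y ^ 2 := by
    funext y
    rw [Real.norm_eq_abs, sq_abs]
    ring
  have hi : Integrable (fun y => c ^ 2 - 2 * c * f y) ν :=
    (integrable_const _).sub (hf.const_mul _)
  rw [he, integral_add hi hf2,
    integral_sub (integrable_const _) (hf.const_mul _), integral_const_mul, integral_const,
    smul_eq_mul]
  ring

theorem integrable_integral_norm_sub_sq (hf : Integrable f ν)
    (hf2 : Integrable (fun x => f x ^ 2) ν) :
    Integrable (fun x => ∫ y, ‖f x - f y‖ ^ 2 ∂ν) ν := by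
  simp_rw [integral_norm_sub_sq hf hf2]
  exact ((hf2.const_mul _).sub (hf.const_mul _)).add (integrable_const _)

/-- The variance identity. -/
theorem integral_integral_norm_sub_sq (hf : Integrable f ν)
    (hf2 : Integrable (fun x => f x ^ 2) ν) :
    ∫ x, ∫ y, ‖f x - f y‖ ^ 2 ∂ν ∂ν =
      2 * (ν.real Set.univ * (∫ x, f x ^ 2 ∂ν) - (∫ x, f x ∂ν) ^ 2) := by
  simp_rw [integral_norm_sub_sq hf hf2]
  have hi : Integrable (fun x => ν.real Set.univ * f x ^ 2 - 2 * (∫ y, f y ∂ν) * f x) ν :=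
    (hf2.const_mul _).sub (hf.const_mul _)
  rw [integral_add hi (integrable_const _), integral_sub (hf2.const_mul _) (hf.const_mul _),
    integral_const_mul, integral_const_mul, integral_const, smul_eq_mul]
  ring

theorem lintegral_lintegral_sub_sq (hf : Integrable f ν)
    (hf2 : Integrable (fun x => f x ^ 2) ν) :
    ∫⁻ x, ∫⁻ y, ‖f x - f y‖ₑ ^ 2 ∂ν ∂ν =
      ENNReal.ofReal (∫ x, ∫ y, ‖f x - f y‖ ^ 2 ∂ν ∂ν) := by
  rw [ofReal_integral_eq_lintegral_ofReal (integrable_integral_norm_sub_sq hf hf2)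
    (ae_of_all _ fun x => integral_nonneg fun y => by positivity)]
  exact lintegral_congr fun x => lintegral_enorm_sq_eq_ofReal (integrable_norm_sub_sq hf hf2 _)

end Variance

/-- The local oscillation of a function is controlled by its gradient. -/
theorem lintegral_lintegral_closedBall_sub_sq_le {φ : E → ℝ} (hφ : ContDiff ℝ ∞ φ)
    (d : ℝ) :
    ∫⁻ x, ∫⁻ y in Metric.closedBall x d, ‖φ x - φ y‖ₑ ^ 2 ≤
      volume (Metric.closedBall (0 : E) d) * (ENNReal.ofReal d ^ 2 * ∫⁻ x, ‖gradient φ x‖ₑ ^ 2) := by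
  have hx (x : E) : ∫⁻ y in Metric.closedBall x d, ‖φ x - φ y‖ₑ ^ 2 =
      ∫⁻ z in Metric.closedBall (0 : E) d, ‖φ (x + z) - φ x‖ₑ ^ 2 := by
    -- Substitute y = x + z; indicators turn both sides into integrals over the whole space, where
    -- translation invariance applies.
    rw [← lintegral_indicator Metric.isClosed_closedBall.measurableSet,
      ← lintegral_indicator Metric.isClosed_closedBall.measurableSet,
      ← lintegral_add_left_eq_self ((Metric.closedBall x d).indicator _) x]
    refine lintegral_congr fun z => ?_
    classical
    simp only [Set.indicator_apply, Metric.mem_closedBall, dist_self_add_left, dist_zero_right]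
    rw [← enorm_neg, neg_sub]
  have hm : Measurable (Function.uncurry fun x z : E => ‖φ (x + z) - φ x‖ₑ ^ 2) := by
    have := hφ.continuous
    exact ((by fun_prop : Continuous fun p : E × E => φ (p.1 + p.2) - φ p.1).measurable.enorm).pow_const 2
  simp_rw [hx]
  -- With the displacement z outside, the translation estimate applies for each fixed z.
  rw [lintegral_lintegral_swap hm.aemeasurable]
  calc _ ≤ ∫⁻ z in Metric.closedBall (0 : E) d, ENNReal.ofReal d ^ 2 * ∫⁻ x, ‖gradient φ x‖ₑ ^ 2 := by
        refine setLIntegral_mono' Metric.isClosed_closedBall.measurableSet fun z hz => ?_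
        refine (lintegral_translate_sub_sq_le hφ z).trans ?_
        gcongr
        rw [← ofReal_norm]
        exact ENNReal.ofReal_le_ofReal (by simpa using hz)
    _ = _ := by rw [setLIntegral_const, mul_comm]

/-- A function is controlled in `L²` by its gradient and its integrals over the cells of a fine
partition of its support. -/
theorem integral_sq_le_of_partition {φ : E → ℝ} (hφ : ContDiff ℝ ∞ φ) (hs : HasCompactSupport φ)
    {κ : Type*} (S : Finset κ) (Q : κ → Set E) (hQ : ∀ k, MeasurableSet (Q k))
    (hdisj : Pairwise (Function.onFun Disjoint Q)) {d V : ℝ} (hd : 0 ≤ d) (hV : 0 ≤ V)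
    (hdiam : ∀ k, ∀ x ∈ Q k, ∀ y ∈ Q k, dist x y ≤ d)
    (hvol : ∀ k, volume (Q k) = ENNReal.ofReal V)
    (hcov : Function.support φ ⊆ ⋃ k ∈ S, Q k) :
    V * ∫ x, φ x ^ 2 ≤ (∑ k ∈ S, (∫ x in Q k, φ x) ^ 2) +
      volume.real (Metric.closedBall (0 : E) d) * d ^ 2 / 2 * ∫ x, ‖gradient φ x‖ ^ 2 := by
  have hi2 := integrable_sq hφ.continuous hs
  have hi : Integrable φ := hφ.continuous.integrable_of_hasCompactSupport hs
  have hsum : ∫ x, φ x ^ 2 = ∑ k ∈ S, ∫ x in Q k, φ x ^ 2 := by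
    rw [← integral_biUnion_finset S (fun k _ => hQ k) (fun i _ j _ hij => hdisj hij)
      (fun k _ => hi2.integrableOn)]
    refine (setIntegral_eq_integral_of_forall_compl_eq_zero fun x hx => ?_).symm
    have : φ x = 0 := by
      by_contra h
      exact hx (hcov h)
    simp [this]
  have hfin (k : κ) : IsFiniteMeasure (volume.restrict (Q k)) := ⟨by simp [hvol]⟩
  have hvar (k : κ) := integral_integral_norm_sub_sq (ν := volume.restrict (Q k))
    hi.integrableOn hi2.integrableOn
  have hr (k : κ) : (volume.restrict (Q k)).real Set.univ = V := by
    simp [Measure.real, hvol, hV]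
  simp only [hr] at hvar
  -- A cell lies in the ball of radius d around each of its points, so the double integral of the
  -- variance identity is at most the local oscillation.
  have hloc (k : κ) : ENNReal.ofReal (2 * (V * (∫ x in Q k, φ x ^ 2) - (∫ x in Q k, φ x) ^ 2)) ≤
      ∫⁻ x in Q k, ∫⁻ y in Metric.closedBall x d, ‖φ x - φ y‖ₑ ^ 2 := by
    rw [← hvar, ← lintegral_lintegral_sub_sq hi.integrableOn hi2.integrableOn]
    refine setLIntegral_mono' (hQ k) fun x hx => lintegral_mono_set fun y hy => ?_
    exact hdiam k y hy x hx
  -- Nonnegativity lets the sum pass through `ENNReal.ofReal`, which truncates negative values.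
  have hnn (k : κ) : 0 ≤ 2 * (V * (∫ x in Q k, φ x ^ 2) - (∫ x in Q k, φ x) ^ 2) := by
    rw [← hvar]
    exact integral_nonneg fun x => integral_nonneg fun y => by positivity
  have hle : ∑ k ∈ S, ENNReal.ofReal (2 * (V * (∫ x in Q k, φ x ^ 2) - (∫ x in Q k, φ x) ^ 2)) ≤
      ∫⁻ x, ∫⁻ y in Metric.closedBall x d, ‖φ x - φ y‖ₑ ^ 2 := by
    refine (Finset.sum_le_sum fun k _ => hloc k).trans ?_
    rw [← lintegral_biUnion_finset (fun i _ j _ hij => hdisj hij) (fun k _ => hQ k)]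
    exact setLIntegral_le_lintegral _ _
  have h := hle.trans (lintegral_lintegral_closedBall_sub_sq_le hφ d)
  rw [← ENNReal.ofReal_sum_of_nonneg fun k _ => hnn k,
    lintegral_enorm_sq_eq_ofReal (integrable_norm_gradient_sq hφ hs),
    ← ENNReal.ofReal_toReal (measure_closedBall_lt_top (x := (0 : E)) (r := d)).ne,
    ← ENNReal.ofReal_pow hd, ← ENNReal.ofReal_mul (by positivity),
    ← ENNReal.ofReal_mul (by positivity), ENNReal.ofReal_le_ofReal_iff (by positivity),
    ← Finset.mul_sum, Finset.sum_sub_distrib, ← Finset.mul_sum, ← hsum] at h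
  change _ ≤ volume.real _ * _ at h
  linarith

end GradientEstimates

/-! ### Partition into small cubes. -/

section Cells

variable {n : ℕ}

/-- The half-open cube of side `h` with lower corner `h k`. -/
def cell (h : ℝ) (k : Fin n → ℤ) : Set (EuclideanSpace ℝ (Fin n)) :=
  WithLp.ofLp ⁻¹' Set.pi Set.univ fun i => Set.Ico (h * k i) (h * k i + h)

/-- A point determines the index of its cell by rounding down; disjointness and covering both follow
from this. -/
theorem mem_cell_iff {h : ℝ} (hh : 0 < h) {k : Fin n → ℤ} {x : EuclideanSpace ℝ (Fin n)} :
    x ∈ cell h k ↔ ∀ i, ⌊x i / h⌋ = k i := by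
  simp only [cell, Set.mem_preimage, Set.mem_univ_pi, Set.mem_Ico, Int.floor_eq_iff]
  refine forall_congr' fun i => ?_
  rw [le_div_iff₀ hh, div_lt_iff₀ hh, add_mul, one_mul, mul_comm h]

theorem measurableSet_cell (h : ℝ) (k : Fin n → ℤ) : MeasurableSet (cell h k) :=
  (PiLp.volume_preserving_ofLp (Fin n)).measurable
    (MeasurableSet.univ_pi fun _ => measurableSet_Ico)

theorem volume_cell {h : ℝ} (hh : 0 ≤ h) (k : Fin n → ℤ) :
    volume (cell h k) = ENNReal.ofReal (h ^ n) := by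
  rw [cell, (PiLp.volume_preserving_ofLp (Fin n)).measure_preimage
    (MeasurableSet.univ_pi fun _ => measurableSet_Ico).nullMeasurableSet, Real.volume_pi_Ico]
  simp [ENNReal.ofReal_pow hh]

theorem pairwise_disjoint_cell {h : ℝ} (hh : 0 < h) :
    Pairwise (Function.onFun Disjoint (cell (n := n) h)) := by
  intro k l hkl
  refine Set.disjoint_left.2 fun x hx hy => hkl ?_
  rw [mem_cell_iff hh] at hx hy
  exact funext fun i => (hx i).symm.trans (hy i)

theorem dist_le_of_mem_cell {h : ℝ} (hh : 0 ≤ h) {k : Fin n → ℤ}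
    {x y : EuclideanSpace ℝ (Fin n)} (hx : x ∈ cell h k) (hy : y ∈ cell h k) :
    dist x y ≤ h * √n := by
  rw [EuclideanSpace.dist_eq, mul_comm, ← Real.sqrt_sq hh, ← Real.sqrt_mul (by positivity)]
  refine Real.sqrt_le_sqrt ?_
  calc ∑ i, dist (x i) (y i) ^ 2 ≤ ∑ _i : Fin n, h ^ 2 := by
        refine Finset.sum_le_sum fun i _ => ?_
        have h1 := hx i (Set.mem_univ i)
        have h2 := hy i (Set.mem_univ i)
        simp only [Set.mem_Ico] at h1 h2
        rw [Real.dist_eq, sq_abs, sq_le_sq, abs_of_nonneg hh]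
        exact (abs_sub_lt_iff.2 ⟨by linarith, by linarith⟩).le
    _ = _ := by simp

theorem exists_finset_subset_biUnion_cell {Ω : Set (EuclideanSpace ℝ (Fin n))}
    (hb : Bornology.IsBounded Ω) {h : ℝ} (hh : 0 < h) :
    ∃ S : Finset (Fin n → ℤ), Ω ⊆ ⋃ k ∈ S, cell h k := by
  obtain ⟨R, hR⟩ := hb.subset_closedBall 0
  refine ⟨Finset.Icc (fun _ => ⌊-R / h⌋) (fun _ => ⌊R / h⌋), fun x hx => ?_⟩
  have hi (i : Fin n) : |x i| ≤ R := by
    have h1 := hR hx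
    rw [mem_closedBall_zero_iff] at h1
    exact (PiLp.norm_apply_le x i).trans h1
  simp only [Set.mem_iUnion]
  refine ⟨fun i => ⌊x i / h⌋, ?_, (mem_cell_iff hh).2 fun i => rfl⟩
  rw [Finset.mem_Icc]
  exact ⟨fun i => Int.floor_le_floor (by have := abs_le.1 (hi i); gcongr; exact this.1),
    fun i => Int.floor_le_floor (by have := abs_le.1 (hi i); gcongr; exact this.2)⟩

/-- A test function on a bounded set is controlled in `L²` by finitely many local integrals, up
to a small multiple of its gradient. -/
theorem exists_cells_integral_sq_le {Ω : Set (EuclideanSpace ℝ (Fin n))}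
    (hb : Bornology.IsBounded Ω) {ε : ℝ} (hε : 0 < ε) :
    ∃ (h : ℝ) (S : Finset (Fin n → ℤ)), 0 < h ∧ ∀ φ, IsTest Ω φ →
      ∫ x, φ x ^ 2 ≤ (h ^ n)⁻¹ * (∑ k ∈ S, (∫ x in cell h k, φ x) ^ 2) +
        ε * ∫ x, ‖gradient φ x‖ ^ 2 := by
  -- With d = h√n the gradient coefficient in `integral_sq_le_of_partition` scales as h ^ n * (C * h
  -- ^ 2). The side h makes C * h ^ 2 ≤ ε; dividing by C + 1 covers the case C = 0.
  set C : ℝ := volume.real (Metric.closedBall (0 : EuclideanSpace ℝ (Fin n)) (√n)) * n / 2 with hC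
  have hC0 : 0 ≤ C := by positivity
  set h : ℝ := √(ε / (C + 1)) with hh
  have hpos : 0 < h := Real.sqrt_pos.2 (by positivity)
  have hsq : C * h ^ 2 ≤ ε := by
    rw [hh, Real.sq_sqrt (by positivity), mul_div_assoc', div_le_iff₀ (by positivity)]
    nlinarith
  obtain ⟨S, hS⟩ := exists_finset_subset_biUnion_cell hb hpos
  refine ⟨h, S, hpos, fun φ hφ => ?_⟩
  have key := integral_sq_le_of_partition hφ.smooth hφ.compact S (cell h)
    (measurableSet_cell h) (pairwise_disjoint_cell hpos) (d := h * √n) (V := h ^ n)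
    (by positivity) (by positivity) (fun k x hx y hy => dist_le_of_mem_cell hpos.le hx hy)
    (volume_cell hpos.le) ((subset_tsupport φ).trans (hφ.support.trans hS))
  have hvol : volume.real (Metric.closedBall (0 : EuclideanSpace ℝ (Fin n)) (h * √n)) =
      h ^ n * volume.real (Metric.closedBall (0 : EuclideanSpace ℝ (Fin n)) (√n)) := by
    rw [Measure.real, Measure.addHaar_closedBall_mul _ _ hpos.le (Real.sqrt_nonneg _)]
    simp [Measure.real, hpos.le]
  rw [hvol, mul_pow, Real.sq_sqrt n.cast_nonneg] at key
  have hg : 0 ≤ ∫ x, ‖gradient φ x‖ ^ 2 := integral_nonneg fun x => by positivity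
  have hV : 0 < h ^ n := by positivity
  have key' : h ^ n * ∫ x, φ x ^ 2 ≤ (∑ k ∈ S, (∫ x in cell h k, φ x) ^ 2) +
      h ^ n * (ε * ∫ x, ‖gradient φ x‖ ^ 2) := by
    refine key.trans ?_
    have : h ^ n * ((C * h ^ 2) * ∫ x, ‖gradient φ x‖ ^ 2) ≤
        h ^ n * (ε * ∫ x, ‖gradient φ x‖ ^ 2) := by gcongr
    rw [hC] at this
    linarith
  rw [← mul_le_mul_iff_right₀ hV, mul_add, mul_inv_cancel_left₀ hV.ne']
  exact key'

end Cells

/-! ### Poincaré and Rellich on H¹₀(Ω). -/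

section SobolevSpace

variable {n : ℕ} {Ω : Set (EuclideanSpace ℝ (Fin n))}

/-- The inclusion of `H¹₀(Ω)` into `L²(Ω)`. -/
noncomputable def valL (Ω : Set (EuclideanSpace ℝ (Fin n))) : H10 Ω →L[ℝ] L2 Ω :=
  (WithLp.fstL 2 ℝ (L2 Ω) (L2vec Ω)).comp (testGraph Ω).topologicalClosure.subtypeL

/-- The weak gradient as a bounded operator. -/
noncomputable def gradL (Ω : Set (EuclideanSpace ℝ (Fin n))) : H10 Ω →L[ℝ] L2vec Ω :=
  (WithLp.sndL 2 ℝ (L2 Ω) (L2vec Ω)).comp (testGraph Ω).topologicalClosure.subtypeL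

@[simp] theorem valL_apply (u : H10 Ω) : valL Ω u = u.val := rfl

@[simp] theorem gradL_apply (u : H10 Ω) : gradL Ω u = u.grad := rfl

theorem H10.inner_eq (u v : H10 Ω) : ⟪u, v⟫_ℝ = ⟪u.val, v.val⟫_ℝ + ⟪u.grad, v.grad⟫_ℝ :=
  WithLp.prod_inner_apply (u : WithLp 2 (L2 Ω × L2vec Ω)) v

theorem H10.norm_sq_eq (u : H10 Ω) : ‖u‖ ^ 2 = ‖u.val‖ ^ 2 + ‖u.grad‖ ^ 2 :=
  WithLp.prod_norm_sq_eq_of_L2 (u : WithLp 2 (L2 Ω × L2vec Ω))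

theorem Lp_norm_sq_eq_integral {α F : Type*} [MeasurableSpace α] {ν : Measure α}
    [NormedAddCommGroup F] [InnerProductSpace ℝ F] (f : Lp F 2 ν) :
    ‖f‖ ^ 2 = ∫ x, ‖f x‖ ^ 2 ∂ν := by
  rw [← real_inner_self_eq_norm_sq, L2.inner_def]
  simp_rw [real_inner_self_eq_norm_sq]

/-- A closed condition on the function and its gradient that holds for test functions holds on
`H¹₀(Ω)`. -/
theorem H10.induction_of_isClosed {P : L2 Ω → L2vec Ω → Prop}
    (hP : IsClosed {p : WithLp 2 (L2 Ω × L2vec Ω) | P p.fst p.snd})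
    (htest : ∀ (f : L2 Ω) (g : L2vec Ω) (φ : EuclideanSpace ℝ (Fin n) → ℝ), IsTest Ω φ →
      f =ᵐ[volume.restrict Ω] φ → g =ᵐ[volume.restrict Ω] (fun x => gradient φ x) → P f g)
    (u : H10 Ω) : P u.val u.grad := by
  have h : ((testGraph Ω).topologicalClosure : Set (WithLp 2 (L2 Ω × L2vec Ω))) ⊆
      {p | P p.fst p.snd} := by
    rw [Submodule.topologicalClosure_coe]
    refine closure_minimal ?_ hP
    rintro p ⟨φ, hφ, h1, h2⟩
    exact htest _ _ φ hφ h1 h2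
  exact h u.2

/-- Functions supported in Ω lose nothing when integrated over the whole space, so the whole-space
estimates transfer to `L2 Ω` and `L2vec Ω`. -/
theorem norm_sq_eq_of_test {F : Type*} [NormedAddCommGroup F] [InnerProductSpace ℝ F]
    {f : Lp F 2 (volume.restrict Ω)} {ψ : EuclideanSpace ℝ (Fin n) → F}
    (hf : f =ᵐ[volume.restrict Ω] ψ) (hψ : tsupport ψ ⊆ Ω) : ‖f‖ ^ 2 = ∫ x, ‖ψ x‖ ^ 2 := by
  rw [Lp_norm_sq_eq_integral,
    integral_congr_ae (hf.mono fun x hx => by rw [hx] : _ =ᵐ[_] fun x => ‖ψ x‖ ^ 2)]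
  refine setIntegral_eq_integral_of_forall_compl_eq_zero fun x hx => ?_
  rw [image_eq_zero_of_notMem_tsupport fun h => hx (hψ h)]
  simp

theorem IsTest.norm_sq {φ : EuclideanSpace ℝ (Fin n) → ℝ} (hφ : IsTest Ω φ) {f : L2 Ω}
    (hf : f =ᵐ[volume.restrict Ω] φ) : ‖f‖ ^ 2 = ∫ x, φ x ^ 2 := by
  rw [norm_sq_eq_of_test hf hφ.support]
  simp

theorem IsTest.norm_gradient_sq {φ : EuclideanSpace ℝ (Fin n) → ℝ} (hφ : IsTest Ω φ)
    {g : L2vec Ω} (hg : g =ᵐ[volume.restrict Ω] fun x => gradient φ x) :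
    ‖g‖ ^ 2 = ∫ x, ‖gradient φ x‖ ^ 2 :=
  norm_sq_eq_of_test hg ((tsupport_gradient_subset φ).trans hφ.support)

theorem volume_restrict_cell_ne_top {h : ℝ} (hh : 0 ≤ h) (k : Fin n → ℤ) :
    volume.restrict Ω (cell h k) ≠ ⊤ :=
  ((Measure.restrict_apply_le _ _).trans_lt (by simp [volume_cell hh])).ne

theorem IsTest.setIntegral_cell {φ : EuclideanSpace ℝ (Fin n) → ℝ} (hφ : IsTest Ω φ) {f : L2 Ω}
    (hf : f =ᵐ[volume.restrict Ω] φ) (h : ℝ) (k : Fin n → ℤ) :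
    ∫ x in cell h k, f x ∂(volume.restrict Ω) = ∫ x in cell h k, φ x := by
  rw [integral_congr_ae (ae_restrict_of_ae hf), Measure.restrict_restrict (measurableSet_cell h k),
    Set.inter_comm, ← Measure.restrict_restrict' (measurableSet_cell h k)]
  refine setIntegral_eq_integral_of_forall_compl_eq_zero fun x hx => ?_
  exact image_eq_zero_of_notMem_tsupport fun h => hx (hφ.support h)

/-- Poincaré inequality on `H¹₀(Ω)` for bounded `Ω`. -/
theorem exists_norm_val_sq_le (hn : 1 ≤ n) (hb : Bornology.IsBounded Ω) :
    ∃ C : ℝ, ∀ u : H10 Ω, ‖u.val‖ ^ 2 ≤ C * ‖u.grad‖ ^ 2 := by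
  obtain ⟨R, hR⟩ := hb.subset_closedBall 0
  -- A shift along the first axis by more than the diameter of the ball of radius R separates Ω from
  -- its translate. The absolute value is there because R has no known sign.
  set z : EuclideanSpace ℝ (Fin n) := PiLp.single 2 ⟨0, hn⟩ (2 * |R| + 1) with hz
  have hzn : ‖z‖ = 2 * |R| + 1 := by
    rw [hz, PiLp.norm_single, Real.norm_eq_abs, abs_of_pos (by positivity)]
  refine ⟨‖z‖ ^ 2 / 2, H10.induction_of_isClosed (P := fun f g => ‖f‖ ^ 2 ≤ ‖z‖ ^ 2 / 2 * ‖g‖ ^ 2)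
    ?_ ?_⟩
  · have h1 := WithLp.prod_continuous_ofLp 2 (L2 Ω) (L2vec Ω)
    exact isClosed_le ((h1.fst.norm).pow 2) (continuous_const.mul ((h1.snd.norm).pow 2))
  · intro f g φ hφ hf hg
    rw [hφ.norm_sq hf, hφ.norm_gradient_sq hg]
    have := two_mul_integral_sq_le hφ.smooth hφ.compact (z := z) fun x => by
      by_contra hne
      have h1 : ‖x + z‖ ≤ R := by
        simpa using hR (hφ.support (subset_tsupport φ (left_ne_zero_of_mul hne)))
      have h2 : ‖x‖ ≤ R := by
        simpa using hR (hφ.support (subset_tsupport φ (right_ne_zero_of_mul hne)))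
      have h3 : ‖z‖ ≤ ‖x + z‖ + ‖x‖ := by simpa using norm_sub_le (x + z) x
      have := le_abs_self R
      linarith
    linarith

/-- The inequality behind Rellich's theorem. -/
theorem exists_cells_norm_val_sq_le (hb : Bornology.IsBounded Ω) {ε : ℝ} (hε : 0 < ε) :
    ∃ (h : ℝ) (S : Finset (Fin n → ℤ)), 0 < h ∧ ∀ u : H10 Ω,
      ‖u.val‖ ^ 2 ≤ (h ^ n)⁻¹ *
        (∑ k ∈ S, (∫ x in cell h k, u.val x ∂(volume.restrict Ω)) ^ 2) + ε * ‖u.grad‖ ^ 2 := by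
  obtain ⟨h, S, hh, H⟩ := exists_cells_integral_sq_le hb hε
  refine ⟨h, S, hh, H10.induction_of_isClosed (P := fun f g => ‖f‖ ^ 2 ≤ (h ^ n)⁻¹ *
        (∑ k ∈ S, (∫ x in cell h k, f x ∂(volume.restrict Ω)) ^ 2) + ε * ‖g‖ ^ 2) ?_ ?_⟩
  · have h1 := WithLp.prod_continuous_ofLp 2 (L2 Ω) (L2vec Ω)
    have h2 (k : Fin n → ℤ) :
        Continuous fun f : L2 Ω => ∫ x in cell h k, f x ∂(volume.restrict Ω) := by
      -- The cell integral is an inner product with an indicator, hence continuous on L².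
      refine Continuous.congr (f := fun f : L2 Ω => ⟪indicatorConstLp 2 (measurableSet_cell h k)
        (volume_restrict_cell_ne_top hh.le k) (1 : ℝ), f⟫_ℝ) (by fun_prop) fun f => ?_
      exact L2.inner_indicatorConstLp_one _ _ _
    refine isClosed_le ((h1.fst.norm).pow 2) (Continuous.add (continuous_const.mul ?_)
      (continuous_const.mul ((h1.snd.norm).pow 2)))
    exact continuous_finsetSum _ fun k _ => ((h2 k).comp h1.fst).pow 2
  · intro f g φ hφ hf hg
    rw [hφ.norm_sq hf, hφ.norm_gradient_sq hg,
      Finset.sum_congr rfl fun k _ => by rw [hφ.setIntegral_cell hf]]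
    exact H φ hφ

/-- An operator that is arbitrarily small off finite-dimensional subspaces is compact. -/
theorem isCompactOperator_of_norm_le_on_orthogonal {H F : Type*} [NormedAddCommGroup H]
    [InnerProductSpace ℝ H] [NormedAddCommGroup F] [NormedSpace ℝ F] [CompleteSpace F]
    (T : H →L[ℝ] F)
    (hT : ∀ ε : ℝ, 0 < ε → ∃ W : Submodule ℝ H, FiniteDimensional ℝ W ∧
      ∀ u ∈ Wᗮ, ‖T u‖ ≤ ε * ‖u‖) : IsCompactOperator T := by
  have h1 (m : ℕ) : ∃ G : H →L[ℝ] F, IsCompactOperator G ∧ ‖G - T‖ ≤ 1 / ((m : ℝ) + 1) := by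
    obtain ⟨W, hW, hle⟩ := hT (1 / ((m : ℝ) + 1)) (by positivity)
    -- The finite-rank approximation is T after projection onto W; the error is T applied to the
    -- component in Wᗮ.
    refine ⟨(T.comp W.subtypeL).comp W.orthogonalProjectionOnto, ?_, ?_⟩
    · exact (isCompactOperator_of_locallyCompactSpace_rng (T.comp W.subtypeL)).comp_clm
        W.orthogonalProjectionOnto
    · refine ContinuousLinearMap.opNorm_le_bound _ (by positivity) fun u => ?_
      have h2 : ((T.comp W.subtypeL).comp W.orthogonalProjectionOnto - T) u =
          -T (u - W.starProjection u) := by simp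
      rw [h2, norm_neg]
      refine (hle _ (W.sub_starProjection_mem_orthogonal u)).trans ?_
      gcongr
      rw [← Submodule.starProjection_orthogonal_val]
      exact Submodule.norm_starProjection_apply_le _ _
  choose G hG hle using h1
  refine isCompactOperator_of_tendsto (l := Filter.atTop) (F := G) ?_ (Filter.Eventually.of_forall hG)
  rw [tendsto_iff_norm_sub_tendsto_zero]
  exact squeeze_zero (fun m => norm_nonneg _) hle tendsto_one_div_add_atTop_nhds_zero_nat

instance : CompleteSpace (H10 Ω) :=
  (testGraph Ω).isClosed_topologicalClosure.completeSpace_coe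

/-- Rellich's theorem for `H¹₀(Ω)`. -/
theorem isCompactOperator_valL (hb : Bornology.IsBounded Ω) : IsCompactOperator (valL Ω) := by
  refine isCompactOperator_of_norm_le_on_orthogonal _ fun ε hε => ?_
  obtain ⟨h, S, hh, H⟩ := exists_cells_norm_val_sq_le hb (sq_pos_of_pos hε)
  let e (k : Fin n → ℤ) : L2 Ω := indicatorConstLp 2 (measurableSet_cell h k)
    (volume_restrict_cell_ne_top hh.le k) (1 : ℝ)
  -- These vectors represent the cell integrals as functionals on H¹₀(Ω), so orthogonality to their
  -- span makes all cell integrals over `S` vanish.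
  let A : Set (H10 Ω) := (fun k => (valL Ω).adjoint (e k)) '' (S : Set (Fin n → ℤ))
  refine ⟨Submodule.span ℝ A, FiniteDimensional.span_of_finite ℝ (S.finite_toSet.image _),
    fun u hu => ?_⟩
  have hz (k) (hk : k ∈ S) : ∫ x in cell h k, u.val x ∂(volume.restrict Ω) = 0 := by
    rw [← L2.inner_indicatorConstLp_one (𝕜 := ℝ) (measurableSet_cell h k)
        (volume_restrict_cell_ne_top hh.le k), ← valL_apply,
        ← ContinuousLinearMap.adjoint_inner_left]
    exact hu _ (Submodule.subset_span ⟨k, hk, rfl⟩)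
  have h1 := H u
  rw [Finset.sum_eq_zero fun k hk => by rw [hz k hk]; simp, mul_zero, zero_add] at h1
  refine le_of_sq_le_sq ?_ (by positivity)
  rw [mul_pow, H10.norm_sq_eq]
  refine h1.trans ?_
  gcongr
  simp

end SobolevSpace

/-! ### The mixed problem in abstract Hilbert spaces. -/

section AbstractMixedProblem

variable {H X Y : Type*} [NormedAddCommGroup H] [InnerProductSpace ℝ H]
  [NormedAddCommGroup X] [InnerProductSpace ℝ X] [NormedAddCommGroup Y] [InnerProductSpace ℝ Y]
  (ι : H →L[ℝ] X) (G : H →L[ℝ] Y)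

/-- The homogeneous problem `lam G* G u = ι* ι u` has only the trivial solution. -/
def IsNonresonant (lam : ℝ) : Prop :=
  ∀ u : H, (∀ v : H, lam * ⟪G u, G v⟫_ℝ - ⟪ι u, ι v⟫_ℝ = 0) → u = 0

variable {ι G}

/-- The product space of tuples `(u, q, r, t)`, grouped as `((u, q), (r, t))`. -/
abbrev MixedSpace (H Y : Type*) : Type _ := WithLp 2 (WithLp 2 (H × H) × WithLp 2 (Y × Y))

/-- The element `(u, q, r, t)`. -/
def MixedSpace.mk (u q : H) (r t : Y) : MixedSpace H Y :=
  WithLp.toLp 2 (WithLp.toLp 2 (u, q), WithLp.toLp 2 (r, t))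

theorem MixedSpace.inner_mk (u q v w : H) (r t s p : Y) :
    ⟪MixedSpace.mk u q r t, MixedSpace.mk v w s p⟫_ℝ =
      ⟪u, v⟫_ℝ + ⟪q, w⟫_ℝ + (⟪r, s⟫_ℝ + ⟪t, p⟫_ℝ) := by
  rw [WithLp.prod_inner_apply, WithLp.prod_inner_apply, WithLp.prod_inner_apply]
  rfl

theorem MixedSpace.inner_mk_snd (q : H) (V : MixedSpace H Y) :
    ⟪MixedSpace.mk 0 q 0 0, V⟫_ℝ = ⟪q, V.fst.snd⟫_ℝ := by
  change ⟪_, MixedSpace.mk V.fst.fst V.fst.snd V.snd.fst V.snd.snd⟫_ℝ = _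
  rw [MixedSpace.inner_mk]
  simp

theorem MixedSpace.norm_mk_snd (q : H) : ‖(MixedSpace.mk 0 q 0 0 : MixedSpace H Y)‖ = ‖q‖ := by
  rw [@norm_eq_sqrt_real_inner (MixedSpace H Y), @norm_eq_sqrt_real_inner H,
    MixedSpace.inner_mk_snd]
  rfl

variable [CompleteSpace H] [CompleteSpace X]

/-- Fredholm alternative for `α G* G u - β ι* ι u = g` in a space with the graph norm of a
compactly embedded domain. -/
theorem exists_forall_inner_sub_eq (hι : IsCompactOperator ι)
    (hH : ∀ u v : H, ⟪u, v⟫_ℝ = ⟪ι u, ι v⟫_ℝ + ⟪G u, G v⟫_ℝ) {α β : ℝ} (hα : 0 < α) (hβ : 0 ≤ β)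
    (hinj : ∀ u : H, (∀ v : H, α * ⟪G u, G v⟫_ℝ - β * ⟪ι u, ι v⟫_ℝ = 0) → u = 0) (g : H) :
    ∃ u : H, ∀ v : H, α * ⟪G u, G v⟫_ℝ - β * ⟪ι u, ι v⟫_ℝ = ⟪g, v⟫_ℝ := by
  have hαβ : 0 < α + β := by linarith
  -- By `hH`, G* G = 1 - K, so the form is that of α - (α + β) K = (α + β)(μ - K).
  set K : H →L[ℝ] H := ι.adjoint.comp ι with hK
  set μ : ℝ := α / (α + β) with hμ
  have hform (u v : H) : α * ⟪G u, G v⟫_ℝ - β * ⟪ι u, ι v⟫_ℝ = (α + β) * ⟪μ • u - K u, v⟫_ℝ := by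
    have h1 : ⟪K u, v⟫_ℝ = ⟪ι u, ι v⟫_ℝ := by
      rw [hK, ContinuousLinearMap.comp_apply, ContinuousLinearMap.adjoint_inner_left]
    rw [inner_sub_left, real_inner_smul_left, h1, hH u v, hμ]
    field_simp
    ring
  have hcomp : IsCompactOperator K := hι.clm_comp ι.adjoint
  -- Since α > 0, μ is nonzero and the alternative for compact K applies: an eigenvector contradicts
  -- `hinj`, and otherwise μ - K is invertible.
  rcases hcomp.hasEigenvalue_or_mem_resolventSet (μ := μ) (by positivity) with h | h
  · obtain ⟨u, hu⟩ := h.exists_hasEigenvector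
    have h1 : K u = μ • u := hu.apply_eq_smul
    exact absurd (hinj u fun v => by rw [hform, h1]; simp) hu.2
  · rw [spectrum.mem_resolventSet_iff] at h
    obtain ⟨T, hT⟩ := h.exists_right_inv
    refine ⟨T ((α + β)⁻¹ • g), fun v => ?_⟩
    have h1 : μ • T ((α + β)⁻¹ • g) - K (T ((α + β)⁻¹ • g)) = (α + β)⁻¹ • g :=
      congrArg (fun S : H →L[ℝ] H => S ((α + β)⁻¹ • g)) hT
    rw [hform, h1, real_inner_smul_left, mul_inv_cancel_left₀ hαβ.ne']

variable [CompleteSpace Y]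

variable (ι G)

/-- The abstract mixed form. -/
noncomputable def mixedForm (D lam : ℝ) (U V : MixedSpace H Y) : ℝ :=
  ⟪G U.fst.fst - U.snd.fst, V.snd.fst⟫_ℝ + ⟪G U.fst.snd - U.snd.snd, V.snd.snd⟫_ℝ
    - ⟪ι U.fst.fst + ι U.fst.snd, ι V.fst.fst⟫_ℝ
    + lam * ⟪U.snd.fst, G V.fst.fst⟫_ℝ + D * ⟪U.snd.snd, G V.fst.snd⟫_ℝ

/-- The bounded operator that represents the mixed form. -/
noncomputable def mixedOp (D lam : ℝ) : MixedSpace H Y →L[ℝ] MixedSpace H Y :=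
  let fst := WithLp.fstL 2 ℝ (WithLp 2 (H × H)) (WithLp 2 (Y × Y))
  let snd := WithLp.sndL 2 ℝ (WithLp 2 (H × H)) (WithLp 2 (Y × Y))
  let u := (WithLp.fstL 2 ℝ H H).comp fst
  let q := (WithLp.sndL 2 ℝ H H).comp fst
  let r := (WithLp.fstL 2 ℝ Y Y).comp snd
  let t := (WithLp.sndL 2 ℝ Y Y).comp snd
  r.adjoint.comp (G.comp u - r) + t.adjoint.comp (G.comp q - t)
    - (ι.comp u).adjoint.comp (ι.comp u + ι.comp q)
    + lam • (G.comp u).adjoint.comp r + D • (G.comp q).adjoint.comp t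

variable {ι G} {D lam : ℝ}

theorem inner_mixedOp (U V : MixedSpace H Y) :
    ⟪mixedOp ι G D lam U, V⟫_ℝ = mixedForm ι G D lam U V := by
  simp only [mixedOp, add_apply, sub_apply, smul_apply, ContinuousLinearMap.comp_apply,
    inner_add_left, inner_sub_left, real_inner_smul_left, map_add, map_sub,
    ContinuousLinearMap.adjoint_inner_left, mixedForm]
  rfl

/-- Riesz representation turns the variational problem into an operator equation. -/
theorem forall_mixedForm_eq_iff {F : MixedSpace H Y → ℝ} {g U : MixedSpace H Y}
    (hF : ∀ V, F V = ⟪g, V⟫_ℝ) :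
    (∀ V, mixedForm ι G D lam U V = F V) ↔ mixedOp ι G D lam U = g := by
  simp only [← inner_mixedOp, hF]
  exact ⟨fun h => ext_inner_right ℝ h, fun h V => by rw [h]⟩

theorem inner_mixedOp_mk (u q v w : H) (r t s p : Y) :
    ⟪mixedOp ι G D lam (MixedSpace.mk u q r t), MixedSpace.mk v w s p⟫_ℝ =
      ⟪G u - r, s⟫_ℝ + ⟪G q - t, p⟫_ℝ - ⟪ι u + ι q, ι v⟫_ℝ
      + lam * ⟪r, G v⟫_ℝ + D * ⟪t, G w⟫_ℝ :=
  inner_mixedOp _ _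

/-- A resonance produces a kernel element of the mixed operator. -/
theorem exists_mixedOp_eq_zero (D : ℝ) (h : ¬ IsNonresonant ι G lam) :
    ∃ U : MixedSpace H Y, U ≠ 0 ∧ mixedOp ι G D lam U = 0 := by
  simp only [IsNonresonant, not_forall] at h
  obtain ⟨φ, h, hφ⟩ := h
  -- With q = t = 0 and r = G φ only the v-equation survives, and it is the resonance equation.
  refine ⟨.mk φ 0 (G φ) 0,
    fun h0 => hφ (congrArg (fun U : MixedSpace H Y => U.fst.fst) h0), ?_⟩
  refine ext_inner_right ℝ fun V => ?_
  obtain ⟨v, w, s, p, rfl⟩ : ∃ u q r t, V = MixedSpace.mk u q r t := ⟨_, _, _, _, rfl⟩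
  rw [inner_mixedOp_mk]
  have := h v
  simp only [sub_self, map_zero, add_zero, inner_zero_left, mul_zero]
  linarith

/-- Test one slot at a time: s and p force r = G u and t = G q, then w = q gives D‖G q‖² = 0, and
with q = 0 the v-equation is the nonresonant one. -/
theorem mixedOp_injective (hG : ∀ q : H, G q = 0 → q = 0) (hD : D ≠ 0)
    (hlam : IsNonresonant ι G lam) : Function.Injective (mixedOp ι G D lam) := by
  rw [injective_iff_map_eq_zero]
  intro U hU
  obtain ⟨u, q, r, t, rfl⟩ : ∃ u q r t, U = MixedSpace.mk u q r t := ⟨_, _, _, _, rfl⟩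
  have hz (v w : H) (s p : Y) : ⟪G u - r, s⟫_ℝ + ⟪G q - t, p⟫_ℝ
      - ⟪ι u + ι q, ι v⟫_ℝ + lam * ⟪r, G v⟫_ℝ + D * ⟪t, G w⟫_ℝ = 0 := by
    rw [← inner_mixedOp_mk, hU, inner_zero_left]
  have hr : G u = r := sub_eq_zero.1 (ext_inner_right ℝ fun s => by simpa using hz 0 0 s 0)
  have ht : G q = t := sub_eq_zero.1 (ext_inner_right ℝ fun p => by simpa using hz 0 0 0 p)
  subst hr ht
  have hq : q = 0 := hG q (by simpa [hD] using hz 0 q 0 0)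
  subst hq
  have hu : u = 0 := hlam u fun v => by
    have := hz v 0 0 0
    simp only [map_zero, inner_zero_right, add_zero, mul_zero] at this
    linarith
  subst hu
  simp only [map_zero]
  rfl

/-- Eliminate r = G u - S and t = G q - P, then solve for q before u, since only the u-equation
contains the coupling. -/
theorem mixedOp_surjective (hι : IsCompactOperator ι)
    (hH : ∀ u v : H, ⟪u, v⟫_ℝ = ⟪ι u, ι v⟫_ℝ + ⟪G u, G v⟫_ℝ)
    (hG : ∀ q : H, G q = 0 → q = 0) (hD : 0 < D) (hlam : 0 < lam)
    (hne : IsNonresonant ι G lam) : Function.Surjective (mixedOp ι G D lam) := by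
  intro g
  obtain ⟨g₁, g₂, S, P, rfl⟩ : ∃ u q r t, g = MixedSpace.mk u q r t := ⟨_, _, _, _, rfl⟩
  -- Here β = 0; the adjoint term is the contribution of -P in t.
  obtain ⟨q, hq⟩ := exists_forall_inner_sub_eq hι hH hD le_rfl
    (fun u hu => hG u (by simpa [hD.ne'] using hu u)) (g₂ + D • G.adjoint P)
  -- Here β = 1; the coupling with the known q has moved to the right-hand side.
  obtain ⟨u, hu⟩ := exists_forall_inner_sub_eq hι hH hlam zero_le_one
    (fun u hu => hne u fun v => by simpa using hu v)
    (g₁ + lam • G.adjoint S + ι.adjoint (ι q))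
  refine ⟨.mk u q (G u - S) (G q - P), ext_inner_right ℝ fun V => ?_⟩
  obtain ⟨v, w, s, p, rfl⟩ : ∃ u q r t, V = MixedSpace.mk u q r t := ⟨_, _, _, _, rfl⟩
  have h1 := hq w
  have h2 := hu v
  rw [inner_mixedOp_mk, MixedSpace.inner_mk]
  simp only [inner_add_left, inner_sub_left, real_inner_smul_left,
    ContinuousLinearMap.adjoint_inner_left, sub_sub_cancel] at h1 h2 ⊢
  linarith

/-- The inverse is bounded by the open mapping theorem; this is the source of the stability and
inf-sup constants. -/
theorem exists_norm_le_mul_norm_of_bijective {E : Type*} [NormedAddCommGroup E]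
    [NormedSpace ℝ E] [CompleteSpace E] {T : E →L[ℝ] E} (hT : Function.Bijective T) :
    ∃ C : ℝ, 0 < C ∧ ∀ U : E, ‖U‖ ≤ C * ‖T U‖ := by
  let e := ContinuousLinearEquiv.ofBijective T (LinearMap.ker_eq_bot.2 hT.1)
    (LinearMap.range_eq_top.2 hT.2)
  obtain ⟨C, hC, h⟩ := (e.symm : E →L[ℝ] E).bound
  refine ⟨C, hC, fun U => ?_⟩
  have := h (T U)
  rwa [show (e.symm : E →L[ℝ] E) (T U) = U from e.symm_apply_apply U] at this

/-- Unique solvability with bounds for a family of functionals that contains the zero functional,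
represented by the vectors `T f`. -/
theorem mixed_wellPosed_iff (hι : IsCompactOperator ι)
    (hH : ∀ u v : H, ⟪u, v⟫_ℝ = ⟪ι u, ι v⟫_ℝ + ⟪G u, G v⟫_ℝ)
    (hG : ∀ q : H, G q = 0 → q = 0) (hD : 0 < D) (hlam : 0 < lam)
    {E : Type*} [NormedAddCommGroup E] {F : E → MixedSpace H Y → ℝ} {T : E → MixedSpace H Y}
    (hF : ∀ f V, F f V = ⟪T f, V⟫_ℝ) {M : ℝ} (hT : ∀ f, ‖T f‖ ≤ M * ‖f‖) :
    ((∀ f : E, ∃! U : MixedSpace H Y, ∀ V, mixedForm ι G D lam U V = F f V) ∧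
      ∃ C : ℝ, ∀ (f : E) (U : MixedSpace H Y),
        (∀ V, mixedForm ι G D lam U V = F f V) → ‖U‖ ≤ C * ‖f‖) ↔
    IsNonresonant ι G lam := by
  have hiff (f : E) (U : MixedSpace H Y) :
      (∀ V, mixedForm ι G D lam U V = F f V) ↔ mixedOp ι G D lam U = T f :=
    forall_mixedForm_eq_iff (hF f)
  simp only [hiff]
  constructor
  · rintro ⟨h, -⟩
    by_contra hne
    obtain ⟨U, hU, h0⟩ := exists_mixedOp_eq_zero D hne
    -- `T` is not assumed linear; the norm bound alone makes the datum 0 the homogeneous problem.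
    have hT0 : T 0 = 0 := by simpa using hT 0
    exact hU ((h 0).unique (h0.trans hT0.symm) ((map_zero _).trans hT0.symm))
  · intro hne
    have hbij : Function.Bijective (mixedOp ι G D lam) :=
      ⟨mixedOp_injective hG hD.ne' hne, mixedOp_surjective hι hH hG hD hlam hne⟩
    obtain ⟨C, hC0, hC⟩ := exists_norm_le_mul_norm_of_bijective hbij
    refine ⟨fun f => hbij.existsUnique _, C * M, fun f U hU => (hC U).trans ?_⟩
    rw [hU, mul_assoc]
    gcongr
    exact hT f

theorem mixed_wellPosedDual_iff (hι : IsCompactOperator ι)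
    (hH : ∀ u v : H, ⟪u, v⟫_ℝ = ⟪ι u, ι v⟫_ℝ + ⟪G u, G v⟫_ℝ)
    (hG : ∀ q : H, G q = 0 → q = 0) (hD : 0 < D) (hlam : 0 < lam) :
    ((∀ F : MixedSpace H Y →L[ℝ] ℝ, ∃! U : MixedSpace H Y, ∀ V, mixedForm ι G D lam U V = F V) ∧
      ∃ C : ℝ, ∀ (F : MixedSpace H Y →L[ℝ] ℝ) (U : MixedSpace H Y),
        (∀ V, mixedForm ι G D lam U V = F V) → ‖U‖ ≤ C * ‖F‖) ↔
    IsNonresonant ι G lam :=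
  mixed_wellPosed_iff hι hH hG hD hlam (F := fun (F : MixedSpace H Y →L[ℝ] ℝ) V => F V)
    (T := fun F => (InnerProductSpace.toDual ℝ (MixedSpace H Y)).symm F)
    (fun F V => (InnerProductSpace.toDual_symm_apply).symm) (M := 1) fun F => by
      rw [LinearIsometryEquiv.norm_map, one_mul]

/-- The supremum in the inf-sup condition is at least the norm of the mixed operator. -/
theorem norm_mixedOp_le_iSup (U : MixedSpace H Y) :
    ‖mixedOp ι G D lam U‖ ≤
      ⨆ V : {V : MixedSpace H Y // V ≠ 0}, |mixedForm ι G D lam U V| / ‖(V : MixedSpace H Y)‖ := by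
  by_cases h : mixedOp ι G D lam U = 0
  · rw [h, norm_zero]
    exact Real.iSup_nonneg fun V => by positivity
  -- Boundedness must be shown because an unbounded real supremum is 0 by convention.
  · have hbdd : BddAbove (Set.range fun V : {V : MixedSpace H Y // V ≠ 0} =>
        |mixedForm ι G D lam U V| / ‖(V : MixedSpace H Y)‖) := by
      refine ⟨‖mixedOp ι G D lam U‖, ?_⟩
      rintro _ ⟨V, rfl⟩
      refine div_le_of_le_mul₀ (norm_nonneg _) (norm_nonneg _) ?_
      rw [← inner_mixedOp]
      exact abs_real_inner_le_norm _ _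
    -- The test vector V = B U attains the norm.
    refine le_trans (le_of_eq ?_) (le_ciSup hbdd ⟨_, h⟩)
    have h' : ‖mixedOp ι G D lam U‖ ≠ 0 := norm_ne_zero_iff.2 h
    rw [← inner_mixedOp, real_inner_self_eq_norm_sq, abs_of_nonneg (by positivity), sq,
      mul_div_cancel_right₀ _ h']

/-- The inf-sup condition amounts to ‖U‖ ≤ C‖B U‖: a kernel element violates it, and bijectivity of
B provides it. -/
theorem mixed_infSup_iff
    (hι : IsCompactOperator ι) (hH : ∀ u v : H, ⟪u, v⟫_ℝ = ⟪ι u, ι v⟫_ℝ + ⟪G u, G v⟫_ℝ)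
    (hG : ∀ q : H, G q = 0 → q = 0) (hD : 0 < D) (hlam : 0 < lam) :
    (∃ γ : ℝ, 0 < γ ∧ ∀ U : MixedSpace H Y, γ * ‖U‖ ≤
      ⨆ V : {V : MixedSpace H Y // V ≠ 0}, |mixedForm ι G D lam U V| / ‖(V : MixedSpace H Y)‖) ↔
    IsNonresonant ι G lam := by
  constructor
  · rintro ⟨γ, hγ, h⟩
    by_contra hne
    obtain ⟨U, hU, h0⟩ := exists_mixedOp_eq_zero D hne
    have h2 := h U
    simp only [← inner_mixedOp, h0, inner_zero_left, abs_zero, zero_div,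
      Real.iSup_const_zero] at h2
    have : 0 < γ * ‖U‖ := mul_pos hγ (norm_pos_iff.2 hU)
    linarith
  · intro hne
    obtain ⟨C, hC0, hC⟩ := exists_norm_le_mul_norm_of_bijective
      ⟨mixedOp_injective hG hD.ne' hne, mixedOp_surjective hι hH hG hD hlam hne⟩
    refine ⟨C⁻¹, inv_pos.2 hC0, fun U => ?_⟩
    rw [inv_mul_le_iff₀ hC0]
    refine (hC U).trans ?_
    gcongr
    exact norm_mixedOp_le_iSup U

end AbstractMixedProblem

/-! ### Application to the Cahn–Hilliard system. -/

section CahnHilliardProblem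

variable {n : ℕ} {Ω : Set (EuclideanSpace ℝ (Fin n))} {D lam : ℝ}

theorem eq_zero_of_gradL_eq_zero (hn : 1 ≤ n) (hb : Bornology.IsBounded Ω) (q : H10 Ω)
    (hq : gradL Ω q = 0) : q = 0 := by
  obtain ⟨C, hC⟩ := exists_norm_val_sq_le hn hb
  have h2 := hC q
  have h3 := H10.norm_sq_eq q
  rw [← gradL_apply, hq] at h2 h3
  have h4 : ‖q‖ ^ 2 = 0 := le_antisymm (by simp at h2 h3; simp [h3, h2]) (sq_nonneg _)
  exact norm_eq_zero.1 (pow_eq_zero_iff two_ne_zero |>.1 h4)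

theorem inner_L2_eq (f g : L2 Ω) : ⟪f, g⟫_ℝ = ∫ x in Ω, f x * g x := by
  simp only [L2.inner_def, RCLike.inner_apply, conj_trivial, mul_comm]

theorem inner_L2vec_eq (f g : L2vec Ω) : ⟪f, g⟫_ℝ = ∫ x in Ω, inner ℝ (f x) (g x) :=
  L2.inner_def _ _

/-- The only μ with lam * μ = 1 is lam⁻¹, and the eigenvalue equation there is the resonance
equation divided by lam. -/
theorem isNonresonant_iff (hlam : 0 < lam) : IsNonresonant (valL Ω) (gradL Ω) lam ↔
    ∀ μ : ℝ, IsDirichletEigenvalue Ω μ → lam * μ ≠ 1 := by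
  simp only [IsDirichletEigenvalue, ← inner_L2_eq, ← inner_L2vec_eq]
  constructor
  · rintro h μ ⟨φ, hφ, he⟩ h1
    refine hφ (h φ fun v => ?_)
    rw [gradL_apply, gradL_apply, he, ← mul_assoc, h1, one_mul]
    exact sub_self _
  · intro h u hu
    by_contra hne
    refine h lam⁻¹ ⟨u, hne, fun v => ?_⟩ (mul_inv_cancel₀ hlam.ne')
    have := sub_eq_zero.1 (hu v)
    simp only [valL_apply, gradL_apply] at this
    rw [← this, inv_mul_cancel_left₀ hlam.ne']

theorem b_eq_mixedForm (U V : Space Ω) :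
    b Ω D lam U V = mixedForm (valL Ω) (gradL Ω) D lam U V := by
  have i1 (f g : L2 Ω) : Integrable (fun x => f x * g x) (volume.restrict Ω) := by
    simpa [mul_comm] using L2.integrable_inner (𝕜 := ℝ) f g
  have i2 (f g : L2vec Ω) : Integrable (fun x => inner ℝ (f x) (g x)) (volume.restrict Ω) :=
    L2.integrable_inner (𝕜 := ℝ) f g
  rw [← mixed_eq_b, a, c, c, integral_add, integral_add, integral_add, integral_add, integral_add]
  · simp only [mixedForm, ← inner_L2_eq, ← inner_L2vec_eq, inner_add_left, inner_sub_left,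
      real_inner_smul_left, valL_apply, gradL_apply, real_inner_comm _ (V.snd.fst),
      real_inner_comm _ (V.snd.snd)]
    ring
  all_goals first
    | exact i1 _ _
    | exact i2 _ _
    | exact (i1 _ _).add (i1 _ _)
    | exact ((i1 _ _).add (i1 _ _)).add (i2 _ _)

theorem wellPosedDual_iff (hn : 1 ≤ n) (hb : Bornology.IsBounded Ω) (hD : 0 < D)
    (hlam : 0 < lam) :
    WellPosedDual Ω D lam ↔ IsNonresonant (valL Ω) (gradL Ω) lam := by
  simp only [WellPosedDual, IsMixedSolution, mixed_eq_b, b_eq_mixedForm]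
  exact mixed_wellPosedDual_iff (isCompactOperator_valL hb) H10.inner_eq
    (eq_zero_of_gradL_eq_zero hn hb) hD hlam

theorem wellPosed_iff (hn : 1 ≤ n) (hb : Bornology.IsBounded Ω) (hD : 0 < D) (hlam : 0 < lam) :
    WellPosed Ω D lam ↔ IsNonresonant (valL Ω) (gradL Ω) lam := by
  simp only [WellPosed, IsMixedSolution, mixed_eq_b, b_eq_mixedForm]
  refine mixed_wellPosed_iff (isCompactOperator_valL hb) H10.inner_eq
    (eq_zero_of_gradL_eq_zero hn hb) hD hlam (F := load Ω)
    -- The load is ⟨-f, ι w⟩, so its representing vector sits in the w-slot.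
    (T := fun f => .mk 0 ((valL Ω).adjoint (-f)) 0 0) (fun f V => ?_)
    (M := ‖(valL Ω).adjoint‖) fun f => ?_
  · rw [load, MixedSpace.inner_mk_snd, ContinuousLinearMap.adjoint_inner_left, inner_neg_left,
      inner_L2_eq]
    simp only [neg_mul, integral_neg, valL_apply]
  · rw [MixedSpace.norm_mk_snd, ← norm_neg f]
    exact ContinuousLinearMap.le_opNorm _ _

theorem infSup_iff (hn : 1 ≤ n) (hb : Bornology.IsBounded Ω) (hD : 0 < D) (hlam : 0 < lam) :
    InfSup Ω D lam ↔ IsNonresonant (valL Ω) (gradL Ω) lam := by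
  rw [← mixed_infSup_iff (isCompactOperator_valL hb) H10.inner_eq
    (eq_zero_of_gradL_eq_zero hn hb) hD hlam]
  simp only [InfSup, b_eq_mixedForm]

end CahnHilliardProblem

end CahnHilliard

theorem mainTheorem2 (n : ℕ) (hn : 1 ≤ n) (Ω : Set (EuclideanSpace ℝ (Fin n)))
    (hΩ : IsOpen Ω) (hb : Bornology.IsBounded Ω) (D lam : ℝ) (hD : 0 < D) (hlam : 0 < lam) :
    (CahnHilliard.WellPosed Ω D lam ↔
      ∀ μ : ℝ, CahnHilliard.IsDirichletEigenvalue Ω μ → lam * μ ≠ 1) ∧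
    (CahnHilliard.WellPosedDual Ω D lam ↔
      ∀ μ : ℝ, CahnHilliard.IsDirichletEigenvalue Ω μ → lam * μ ≠ 1) ∧
    (CahnHilliard.InfSup Ω D lam ↔
      ∀ μ : ℝ, CahnHilliard.IsDirichletEigenvalue Ω μ → lam * μ ≠ 1) := by
  rw [← CahnHilliard.isNonresonant_iff hlam]
  exact ⟨CahnHilliard.wellPosed_iff hn hb hD hlam, CahnHilliard.wellPosedDual_iff hn hb hD hlam,
    CahnHilliard.infSup_iff hn hb hD hlam⟩
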